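/- Let $p$ be a prime and $k\ge 1$ an integer. For a Boolean function $f:\{0,1\}^n\to\{0,1\}$ let $\deg_{p^k}(f)$ be the degree of the unique multilinear polynomial over $\mathbb{Z}/p^k\mathbb{Z}$ that takes the value $f(x)$ at every $x\in\{0,1\}^n$, and call $f$ non-degenerate if it depends on all of its $n$ variables, i.e. if for every $t\in\{1,\dots,n\}$ there is an $x\in\{0,1\}^n$ such that flipping the $t$-th bit of $x$ changes the value of $f$. Then there is a number $N=N(p,k)$ such that for every $n\ge N$, every non-degenerate function $f:\{0,1\}^n\to\{0,1\}$ satisfies $$\deg_{p^k}(f)\ \ge\ (p-1)\cdot k.$$ This bound is tight: for all sufficiently large $n$ (depending on $p$ and $k$) there is a non-degenerate function $f:\{0,1\}^n\to\{0,1\}$ with $\deg_{p^k}(f)=(p-1)\cdot k$. -/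

import Mathlib

/-- An `n`-bit Boolean function `f : {0,1}ⁿ → {0,1}`. -/
abbrev BoolFun (n : ℕ) : Type := (Fin n → Bool) → Bool

namespace BoolFun

/-- The string `x` with its `t`-th bit flipped. -/
def flip {n : ℕ} (x : Fin n → Bool) (t : Fin n) : Fin n → Bool :=
  Function.update x t (!x t)

/-- `f` is non-degenerate: it depends on all of its input bits, i.e. there is no bit `t`
such that `f x = f (flip x t)` for every `x`. -/
def NonDegenerate {n : ℕ} (f : BoolFun n) : Prop :=
  ¬ ∃ t : Fin n, ∀ x : Fin n → Bool, f x = f (flip x t)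

/-- A bit, read as the element `0` or `1` of `ℤ/mℤ`. -/
def bit (m : ℕ) (b : Bool) : ZMod m := if b then 1 else 0

/-- `P` is a multilinear polynomial over `ℤ/mℤ` that represents `f`, i.e. takes the value `f x`
at every `0`-`1` point `x`. -/
def IsRepresentation {n : ℕ} (m : ℕ) (f : BoolFun n) (P : MvPolynomial (Fin n) (ZMod m)) : Prop :=
  (∀ i, P.degreeOf i ≤ 1) ∧ ∀ x : Fin n → Bool, MvPolynomial.eval (fun i => bit m (x i)) P = bit m (f x)

open MvPolynomial in
/-- The polynomial `∑ₐ f(a) ∏ᵢ ((2aᵢ - 1) xᵢ + 1 - aᵢ)` over `ℤ/mℤ`. -/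
noncomputable def poly {n : ℕ} (m : ℕ) (f : BoolFun n) : MvPolynomial (Fin n) (ZMod m) :=
  ∑ a : Fin n → Bool, C (bit m (f a)) *
    ∏ i, (C (2 * bit m (a i) - 1) * X i + C (1 - bit m (a i)))

/-- The modulo-`m` degree of `f`: the degree of the multilinear polynomial over `ℤ/mℤ` that
represents `f`. That `poly m f` is this polynomial is shown in `isRepresentation_iff`. -/
noncomputable def modDegree {n : ℕ} (m : ℕ) (f : BoolFun n) : ℕ := (poly m f).totalDegree

theorem isRepresentation_poly {n : ℕ} (m : ℕ) (f : BoolFun n) :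
    IsRepresentation m f (poly m f) := by
  constructor
  · intro i
    refine (MvPolynomial.degreeOf_sum_le i _ _).trans (Finset.sup_le fun a _ => ?_)
    refine (MvPolynomial.degreeOf_C_mul_le _ _ _).trans ?_
    refine (MvPolynomial.degreeOf_prod_le i _ _).trans ?_
    have h : ∀ j, MvPolynomial.degreeOf i
        (MvPolynomial.C (2 * bit m (a j) - 1) * MvPolynomial.X j
          + MvPolynomial.C (1 - bit m (a j))) ≤ if i = j then 1 else 0 := by
      intro j
      refine (MvPolynomial.degreeOf_add_le _ _ _).trans (max_le ?_ ?_)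
      · refine (MvPolynomial.degreeOf_C_mul_le _ _ _).trans ?_
        rcases subsingleton_or_nontrivial (ZMod m) with hs | hs
        · rw [Subsingleton.elim (MvPolynomial.X j : MvPolynomial (Fin n) (ZMod m)) 0]
          simp
        · rw [MvPolynomial.degreeOf_X]
      · rw [MvPolynomial.degreeOf_C]; exact Nat.zero_le _
    exact (Finset.sum_le_sum fun j _ => h j).trans (by simp)
  · intro x
    have h : ∀ a : Fin n → Bool, (∏ i, ((2 * bit m (a i) - 1) * bit m (x i) + (1 - bit m (a i))))
        = if a = x then 1 else 0 := by
      intro a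
      split_ifs with hax
      · subst hax
        refine Finset.prod_eq_one fun i _ => ?_
        cases a i <;> simp [bit]
        ring
      · obtain ⟨i, hi⟩ := Function.ne_iff.mp hax
        refine Finset.prod_eq_zero (Finset.mem_univ i) ?_
        revert hi
        cases a i <;> cases x i <;> simp [bit]
    simp [poly, map_sum, map_prod, h]

theorem eq_of_isRepresentation {n : ℕ} {m : ℕ} {f : BoolFun n}
    {P Q : MvPolynomial (Fin n) (ZMod m)} (hP : IsRepresentation m f P)
    (hQ : IsRepresentation m f Q) : P = Q := by
  rw [← sub_eq_zero]
  have hd : ∀ i, (P - Q).degreeOf i ≤ 1 := fun i =>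
    (MvPolynomial.degreeOf_sub_le i P Q).trans (max_le (hP.1 i) (hQ.1 i))
  have he : ∀ x : Fin n → Bool, MvPolynomial.eval (fun i => bit m (x i)) (P - Q) = 0 := by
    intro x
    rw [map_sub, hP.2, hQ.2, sub_self]
  generalize P - Q = R at hd he
  by_contra hR
  obtain ⟨d, hdm, hmin⟩ := R.support.exists_minimal (MvPolynomial.support_nonempty.mpr hR)
  have h1 : ∀ e ∈ R.support, ∀ i, e i ≤ 1 := fun e hes i =>
    (MvPolynomial.monomial_le_degreeOf i hes).trans (hd i)
  have h := he (fun i => decide (d i ≠ 0))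
  rw [MvPolynomial.eval_eq', Finset.sum_eq_single d] at h
  · rw [Finset.prod_eq_one, mul_one] at h
    · exact MvPolynomial.mem_support_iff.mp hdm h
    · intro i _
      by_cases hi : d i = 0 <;> simp [hi, bit]
  · intro e hes hne
    have hnle : ¬ e ≤ d := fun hle => hne (le_antisymm hle (hmin hes hle))
    rw [Finsupp.le_def, not_forall] at hnle
    obtain ⟨i, hi⟩ := hnle
    have hei := h1 e hes i
    have hdi : d i = 0 := by omega
    have hei0 : e i ≠ 0 := by omega
    rw [Finset.prod_eq_zero (Finset.mem_univ i), mul_zero]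
    simp [hdi, bit, hei0]
  · intro hn
    exact absurd hdm hn

/-- `poly m f` is the unique multilinear polynomial over `ℤ/mℤ` representing `f`. -/
theorem isRepresentation_iff {n : ℕ} (m : ℕ) (f : BoolFun n)
    (P : MvPolynomial (Fin n) (ZMod m)) : IsRepresentation m f P ↔ P = poly m f :=
  ⟨fun h => eq_of_isRepresentation h (isRepresentation_poly m f),
    fun h => h ▸ isRepresentation_poly m f⟩

end BoolFun

/-! Lower bound: put D = (p-1)k and suppose the degree is below D. Simon's theorem yields a point x
with many sensitive coordinates. The values of f on flips of x are subset sums of coefficients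
living on sets of size < D, and Ramsey's theorem makes these depend on size alone for subsets of
some T. So flipping U ⊆ T gives h(#U) with Δ^D h = 0. Such an h has a power of p as period; T is as
large as that period, so h is 0-1 valued everywhere, and h 0 ≠ h 1 by sensitivity.
`fwdDiff_iter_ne_zero_of_zero_one` forbids this: h sampled along a progression is p-periodic, 0-1
valued and nonconstant, and `Function.Periodic.not_dvd_fwdDiff_iter` applies.

Tightness: expand the indicator of p ∣ weight in Newton's basis; Fleck's congruence kills the terms
above D. -/

/-! ### Differences of p-periodic integer sequences. -/

theorem Nat.Prime.neg_one_pow_mul_choose_pred {p : ℕ} (hp : p.Prime) {i : ℕ} (hi : i < p) :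
    ((-1) ^ (p - 1 - i) * ((p - 1).choose i : ZMod p)) = 1 := by
  obtain ⟨q, rfl⟩ : ∃ q, p = q + 1 := ⟨p - 1, by have := hp.pos; omega⟩
  have key : ∀ j, j ≤ q → (q.choose j : ZMod (q + 1)) = (-1) ^ j := by
    intro j
    induction j with
    | zero => simp
    | succ j ih =>
      intro hj
      have h0 : (((q + 1).choose (j + 1) : ℕ) : ZMod (q + 1)) = 0 :=
        (ZMod.natCast_eq_zero_iff _ _).2 (hp.dvd_choose_self (by omega) (by omega))
      rw [Nat.choose_succ_succ, Nat.cast_add, ih (by omega)] at h0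
      rw [pow_succ]
      linear_combination h0
  -- The case j = q of `key`, which needs no parity split for p = 2.
  have hq : ((-1 : ZMod (q + 1))) ^ q = 1 := by
    have := key q le_rfl
    simpa using this.symm
  rw [Nat.add_sub_cancel, key i (by omega), ← pow_add, Nat.sub_add_cancel (by omega), hq]

theorem fwdDiff_iter_pred_prime_modEq {p : ℕ} (hp : p.Prime) (g : ℕ → ℤ) (x : ℕ) :
    (fwdDiff 1)^[p - 1] g x ≡ ∑ i ∈ Finset.range p, g (x + i) [ZMOD p] := by
  rw [fwdDiff_iter_eq_sum_shift, Nat.sub_add_cancel hp.pos, ← ZMod.intCast_eq_intCast_iff]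
  push_cast
  refine Finset.sum_congr rfl fun i hi => ?_
  have h := hp.neg_one_pow_mul_choose_pred (Finset.mem_range.1 hi)
  simp only [smul_eq_mul, mul_one]
  push_cast
  rw [h, one_mul]

theorem Function.Periodic.sum_range_add {A : Type*} [AddCommGroup A] {g : ℕ → A} {p : ℕ}
    (hg : g.Periodic p) (x : ℕ) :
    ∑ i ∈ Finset.range p, g (x + i) = ∑ i ∈ Finset.range p, g i := by
  induction x with
  | zero => simp
  | succ x ih =>
    rw [← ih]
    have h1 := Finset.sum_range_succ (fun i => g (x + i)) p
    have h2 := Finset.sum_range_succ' (fun i => g (x + i)) p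
    simp only [hg x, add_zero] at h1 h2
    rw [h1] at h2
    rw [add_right_cancel h2]
    exact Finset.sum_congr rfl fun i _ => by rw [add_assoc, add_comm 1 i]

theorem Function.Periodic.fwdDiff_iter {A : Type*} [AddCommGroup A] {g : ℕ → A} {p : ℕ}
    (hg : g.Periodic p) (h n : ℕ) : ((fwdDiff h)^[n] g).Periodic p := by
  induction n with
  | zero => exact hg
  | succ n ih =>
    intro x
    rw [Function.iterate_succ_apply', fwdDiff, add_right_comm, ih, ih, fwdDiff]

theorem Function.Periodic.sum_range_fwdDiff {A : Type*} [AddCommGroup A] {g : ℕ → A} {p : ℕ}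
    (hg : g.Periodic p) : ∑ i ∈ Finset.range p, fwdDiff 1 g i = 0 := by
  simp only [fwdDiff]
  rw [Finset.sum_range_sub, ← zero_add p, hg, sub_self]

/-- High differences of a `p`-periodic sequence whose period sum is prime to `p` have bounded
`p`-divisibility. -/
theorem Function.Periodic.not_dvd_fwdDiff_iter {p : ℕ} (hp : p.Prime) (k : ℕ) {g : ℕ → ℤ}
    (hg : g.Periodic p) (hsum : ¬ (p : ℤ) ∣ ∑ i ∈ Finset.range p, g i) (x : ℕ) :
    ¬ (p : ℤ) ^ (k + 1) ∣ (fwdDiff 1)^[(p - 1) * (k + 1)] g x := by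
  have hmod : ∀ x, (fwdDiff 1)^[p - 1] g x ≡ ∑ i ∈ Finset.range p, g i [ZMOD p] := fun x => by
    rw [← hg.sum_range_add x]
    exact fwdDiff_iter_pred_prime_modEq hp g x
  induction k generalizing g x with
  | zero =>
    rw [zero_add, pow_one, mul_one]
    exact fun hd => hsum ((hmod x).dvd_iff.1 hd)
  | succ k ih =>
    set w := ∑ i ∈ Finset.range p, g i with hw
    choose r hr using fun x => (hmod x).symm.dvd
    have hp0 : (p : ℤ) ≠ 0 := by exact_mod_cast hp.ne_zero
    -- Induct on r: further differences kill the constant w, leaving a factor p. A difference sums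
    -- to 0 over a period, so p w + p ∑ r = 0 and ∑ r = -w is again prime to p.
    have hfun : (fwdDiff 1)^[p - 1] g = (fun _ => w) + (p : ℤ) • r := by
      funext y
      simp only [Pi.add_apply, Pi.smul_apply, smul_eq_mul]
      linarith [hr y]
    have hrper : r.Periodic p := fun y => by
      have h1 := hr (y + p)
      rw [hg.fwdDiff_iter, hr y] at h1
      exact (mul_left_cancel₀ hp0 h1).symm
    obtain ⟨q, hq⟩ : ∃ q, p - 1 = q + 1 := ⟨p - 2, by have := hp.two_le; omega⟩
    have hrsum : ∑ i ∈ Finset.range p, r i = -w := by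
      have h0 := (hg.fwdDiff_iter 1 q).sum_range_fwdDiff
      rw [← Function.iterate_succ_apply' (fwdDiff 1), Nat.succ_eq_add_one, ← hq, hfun] at h0
      simp only [Pi.add_apply, Pi.smul_apply, smul_eq_mul, Finset.sum_add_distrib,
        Finset.sum_const, Finset.card_range, nsmul_eq_mul, ← Finset.mul_sum, ← mul_add] at h0
      have := (mul_eq_zero.1 h0).resolve_left hp0
      linarith
    have hrsum' : ¬ (p : ℤ) ∣ ∑ i ∈ Finset.range p, r i := by rwa [hrsum, dvd_neg]
    have hconst : (fwdDiff 1)^[(p - 1) * (k + 1)] (fun _ : ℕ => w) = 0 := by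
      obtain ⟨s, hs⟩ : ∃ s, (p - 1) * (k + 1) = s + 1 :=
        ⟨(p - 1) * (k + 1) - 1, by
          have : 0 < (p - 1) * (k + 1) := Nat.mul_pos (by omega) (by omega)
          omega⟩
      rw [hs, Function.iterate_succ_apply, fwdDiff_const]
      exact Function.iterate_fixed (fwdDiff_const 1 (0 : ℤ)) s
    have hstep : (fwdDiff 1)^[(p - 1) * (k + 1 + 1)] g x =
        p * (fwdDiff 1)^[(p - 1) * (k + 1)] r x := by
      rw [mul_add (p - 1) (k + 1) 1, mul_one, Function.iterate_add_apply, hfun,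
        fwdDiff_iter_add, fwdDiff_iter_const_smul, hconst, zero_add]
      rfl
    rw [hstep, pow_succ']
    exact fun hd => ih hrper hrsum' x
      (fun y => by rw [← hrper.sum_range_add y]; exact fwdDiff_iter_pred_prime_modEq hp r y)
      ((mul_dvd_mul_iff_left hp0).1 hd)

/-! ### Sequences modulo p^k with a vanishing iterated difference. -/

theorem fwdDiff_iter_intCast {R : Type*} [Ring R] (h n : ℕ) (g : ℕ → ℤ) (x : ℕ) :
    (((fwdDiff h)^[n] g x : ℤ) : R) = (fwdDiff h)^[n] (fun y => (g y : R)) x := by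
  simp [fwdDiff_iter_eq_sum_shift]

theorem fwdDiff_iter_eq_zero_of_le {A : Type*} [AddCommGroup A] {g : ℕ → A} {h m n : ℕ}
    (hg : (fwdDiff h)^[m] g = 0) (hmn : m ≤ n) : (fwdDiff h)^[n] g = 0 := by
  obtain ⟨s, rfl⟩ := Nat.exists_eq_add_of_le' hmn
  rw [Function.iterate_add_apply, hg]
  exact Function.iterate_fixed (fwdDiff_const h (0 : A)) s

/-- With E the unit shift, E^b - 1 = (1 + E + ... + E^(b-1))(E - 1), and the factors commute. This
permits sampling along progressions. -/
theorem fwdDiff_iter_eq_zero_of_one {A : Type*} [AddCommGroup A] {g : ℕ → A} {n : ℕ}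
    (hg : (fwdDiff 1)^[n] g = 0) (b : ℕ) : (fwdDiff b)^[n] g = 0 := by
  have hE : fwdDiff_aux.fwdDiffₗ ℕ A b =
      (∑ i ∈ Finset.range b, fwdDiff_aux.shiftₗ ℕ A 1 ^ i) * fwdDiff_aux.fwdDiffₗ ℕ A 1 := by
    have h1 : fwdDiff_aux.fwdDiffₗ ℕ A 1 = fwdDiff_aux.shiftₗ ℕ A 1 - 1 := by
      simp [fwdDiff_aux.shiftₗ]
    rw [h1, geom_sum_mul]
    ext f x
    simp [fwdDiff_aux.shiftₗ_pow_apply, fwdDiff]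
  have hc : Commute (∑ i ∈ Finset.range b, fwdDiff_aux.shiftₗ ℕ A 1 ^ i)
      (fwdDiff_aux.fwdDiffₗ ℕ A 1) := by
    refine Commute.sum_left _ _ _ fun i _ => Commute.pow_left ?_ i
    exact (Commute.refl _).add_left (Commute.one_left _)
  rw [← fwdDiff_aux.coe_fwdDiffₗ_pow, hE, hc.mul_pow, Module.End.mul_apply,
    fwdDiff_aux.coe_fwdDiffₗ_pow, hg, map_zero]

theorem fwdDiff_iter_comp_mul_add {A : Type*} [AddCommGroup A] (g : ℕ → A) (a b n x : ℕ) :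
    (fwdDiff 1)^[n] (fun j => g (b * j + a)) x = (fwdDiff b)^[n] g (b * x + a) := by
  simp only [fwdDiff_iter_eq_sum_shift, smul_eq_mul, mul_one]
  refine Finset.sum_congr rfl fun i _ => ?_
  congr 2
  ring

/-- A sequence in `ℤ/p^kℤ` with a vanishing iterated difference has a power of `p` as period. -/
theorem periodic_of_fwdDiff_iter_eq_zero {p : ℕ} (hp : p.Prime) (k : ℕ) {D : ℕ}
    {h : ℕ → ZMod (p ^ k)} (hh : (fwdDiff 1)^[D] h = 0) : h.Periodic (p ^ (k + D)) := by
  intro x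
  have := shift_eq_sum_fwdDiff_iter 1 h (p ^ (k + D)) x
  rw [smul_eq_mul, mul_one] at this
  rw [this, Finset.sum_range_succ', Finset.sum_eq_zero]
  · simp
  · intro i hi
    by_cases hiD : i + 1 < D
    · have hle : i + 1 ≤ p ^ (k + D) := by have := Finset.mem_range.1 hi; omega
      -- The binomial has p-adic valuation k + D - v_p(i+1), which exceeds k because v_p(i+1) < i+1
      -- < D.
      have hf := Nat.factorization_choose_prime_pow hp hle (by omega)
      have hlt : (i + 1).factorization p < i + 1 := Nat.factorization_lt p (by omega)
      have hd : p ^ k ∣ (p ^ (k + D)).choose (i + 1) := by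
        refine (hp.pow_dvd_iff_le_factorization (Nat.choose_pos hle).ne').2 ?_
        omega
      rw [nsmul_eq_mul, (ZMod.natCast_eq_zero_iff _ _).2 hd, zero_mul]
    · rw [fwdDiff_iter_eq_zero_of_le hh (by omega)]
      simp

/-- A sequence of zeros and ones in `ℤ/p^kℤ` with `h 0 ≠ h 1` has a nonvanishing iterated difference
of order `(p - 1) k`. -/
theorem fwdDiff_iter_ne_zero_of_zero_one {p k : ℕ} (hp : p.Prime) (hk : 1 ≤ k)
    {h : ℕ → ZMod (p ^ k)} (hval : ∀ j, h j = 0 ∨ h j = 1) (h01 : h 0 ≠ h 1) :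
    (fwdDiff 1)^[(p - 1) * k] h ≠ 0 := by
  intro hh
  classical
  have : Fact (1 < p ^ k) := ⟨Nat.one_lt_pow (by omega) hp.one_lt⟩
  have hex : ∃ L, h.Periodic (p ^ L) := ⟨_, periodic_of_fwdDiff_iter_eq_zero hp k hh⟩
  obtain ⟨L, hL⟩ : ∃ L, Nat.find hex = L + 1 := by
    refine Nat.exists_eq_succ_of_ne_zero fun h0 => ?_
    have := Nat.find_spec hex
    rw [h0, pow_zero] at this
    exact h01 (this 0).symm
  have hper : h.Periodic (p ^ (L + 1)) := hL ▸ Nat.find_spec hex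
  have hnper : ¬ h.Periodic (p ^ L) := Nat.find_min hex (by omega)
  obtain ⟨a, ha⟩ : ∃ a, h (a + p ^ L) ≠ h a := by
    simpa only [Function.Periodic, not_forall] using hnper
  -- Step p^L from a point where the period p^L fails: g has period p, yet g 0 ≠ g 1. Its period sum
  -- thus lies strictly between 0 and p.
  let g : ℕ → ℤ := fun j => if h (p ^ L * j + a) = 0 then 0 else 1
  have hgcast : (fun j => (g j : ZMod (p ^ k))) = fun j => h (p ^ L * j + a) := by
    funext j
    rcases hval (p ^ L * j + a) with h0 | h1
    · simp [g, h0]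
    · simp [g, h1]
  have hgper : g.Periodic p := fun j => by
    have : p ^ L * (j + p) + a = p ^ L * j + a + p ^ (L + 1) := by ring
    simp only [g, this, hper _]
  have hg0 : ∀ j, 0 ≤ g j := fun j => by simp only [g]; split_ifs <;> simp
  have hg1 : ∀ j, g j ≤ 1 := fun j => by simp only [g]; split_ifs <;> simp
  have hne : g 0 ≠ g 1 := by
    intro he
    have h0 := congrFun hgcast 0
    have h1 := congrFun hgcast 1
    simp only [mul_zero, zero_add, mul_one] at h0 h1
    rw [add_comm, ← h0, ← h1, he] at ha
    exact ha rfl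
  have hp2 := hp.two_le
  have hlt : ∑ i ∈ Finset.range p, g i < p := by
    have : ∑ i ∈ Finset.range p, g i < ∑ i ∈ Finset.range p, (1 : ℤ) := by
      refine Finset.sum_lt_sum (fun i _ => hg1 i) ?_
      by_cases h0 : g 0 = 1
      · exact ⟨1, by simp; omega, lt_of_le_of_ne (hg1 1) (by rw [← h0]; exact hne.symm)⟩
      · exact ⟨0, by simp; omega, lt_of_le_of_ne (hg1 0) h0⟩
    simpa using this
  have hpos : 0 < ∑ i ∈ Finset.range p, g i := by
    refine Finset.sum_pos' (fun i _ => hg0 i) ?_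
    by_cases h0 : g 0 = 0
    · exact ⟨1, by simp; omega, lt_of_le_of_ne (hg0 1) (by rw [← h0]; exact hne)⟩
    · exact ⟨0, by simp; omega, lt_of_le_of_ne (hg0 0) (Ne.symm h0)⟩
  have hnd : ¬ (p : ℤ) ∣ ∑ i ∈ Finset.range p, g i := fun hd =>
    absurd (Int.le_of_dvd hpos hd) (not_le.2 hlt)
  obtain ⟨k, rfl⟩ : ∃ k', k = k' + 1 := ⟨k - 1, by omega⟩
  refine hgper.not_dvd_fwdDiff_iter hp k hnd 0 ?_
  have hz : (((fwdDiff 1)^[(p - 1) * (k + 1)] g 0 : ℤ) : ZMod (p ^ (k + 1))) = 0 := by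
    rw [fwdDiff_iter_intCast, hgcast, fwdDiff_iter_comp_mul_add,
      fwdDiff_iter_eq_zero_of_one hh]
    rfl
  rw [ZMod.intCast_zmod_eq_zero_iff_dvd] at hz
  exact_mod_cast hz

/-- Fleck's congruence, for differences of a `p`-periodic sequence. -/
theorem Function.Periodic.dvd_fwdDiff_iter {p : ℕ} (hp : p.Prime) {g : ℕ → ℤ} (hg : g.Periodic p)
    (k : ℕ) {d : ℕ} (hd : (p - 1) * k < d) (x : ℕ) : (p : ℤ) ^ k ∣ (fwdDiff 1)^[d] g x := by
  induction k generalizing d x with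
  | zero => simp
  | succ k ih =>
    rw [mul_add, mul_one] at hd
    obtain ⟨q, rfl⟩ : ∃ q, p = q + 1 := ⟨p - 1, by have := hp.pos; omega⟩
    rw [Nat.add_sub_cancel] at hd ih
    obtain ⟨e, rfl⟩ : ∃ e, d = q + 1 + e := ⟨d - (q + 1), by omega⟩
    -- Periodicity says (1 + Δ)^p = 1, so Δ^p is minus the sum of C(p,i) Δ^i over 0 < i < p. Each
    -- term gains a factor p and lowers the order by at most p - 1.
    have hs := shift_eq_sum_fwdDiff_iter 1 ((fwdDiff 1)^[e] g) (q + 1) x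
    rw [smul_eq_mul, mul_one, hg.fwdDiff_iter, Finset.sum_range_succ, Finset.sum_range_succ',
      Nat.choose_self, Nat.choose_zero_right, one_smul, one_smul,
      Function.iterate_zero_apply] at hs
    have hs' : (fwdDiff 1)^[q + 1 + e] g x =
        -∑ i ∈ Finset.range q,
          (q + 1).choose (i + 1) • (fwdDiff 1)^[i + 1] ((fwdDiff 1)^[e] g) x := by
      rw [Function.iterate_add_apply]
      linarith
    rw [hs', dvd_neg]
    refine Finset.dvd_sum fun i hi => ?_
    rw [← Function.iterate_add_apply, nsmul_eq_mul, pow_succ']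
    refine mul_dvd_mul ?_ (ih (by omega) x)
    have hi' := Finset.mem_range.1 hi
    exact_mod_cast hp.dvd_choose_self (by omega) (by omega)

/-! ### Ramsey's theorem. -/

/-- The step of the Erdős–Rado argument: a large set has a subset on which the colour of every
nonempty set `U` of at most `d + 1` elements is determined by an element of `U` and `#U`. -/
theorem Finset.exists_subset_color_eq_of_mem.{u, v} {K : Type v} {d : ℕ}
    (hR : ∀ m, ∃ N, ∀ (α : Type u) [DecidableEq α] (S : Finset α), N ≤ S.card →
      ∀ c : Finset α → K, ∃ T ⊆ S, T.card = m ∧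
      ∃ g : ℕ → K, ∀ U ⊆ T, U.card ≤ d → c U = g U.card) (M : ℕ) :
    ∃ N, ∀ (α : Type u) [DecidableEq α] (S : Finset α), N ≤ S.card →
      ∀ c : Finset α → K, ∃ T ⊆ S, T.card = M ∧
      ∃ γ : α → ℕ → K, ∀ U ⊆ T, U.Nonempty → U.card ≤ d + 1 →
        ∃ a ∈ U, c U = γ a (U.card - 1) := by
  induction M with
  | zero =>
    refine ⟨0, fun α _ S _ c => ⟨∅, Finset.empty_subset _, rfl, fun _ _ => c ∅, fun U hU hne => ?_⟩⟩
    exact absurd (Finset.subset_empty.1 hU) hne.ne_empty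
  | succ M ih =>
    obtain ⟨N, hN⟩ := ih
    obtain ⟨N', hN'⟩ := hR N
    refine ⟨N' + 1, fun α _ S hS c => ?_⟩
    obtain ⟨a, ha⟩ := Finset.card_pos.1 (by omega : 0 < S.card)
    -- Make the colours of sets through a depend on size alone, then recurse inside S'. The palette
    -- g of a is indexed by the size without a.
    obtain ⟨S', hS', hcard, g, hg⟩ := hN' α (S.erase a) (by rw [Finset.card_erase_of_mem ha]; omega)
      (fun U => c (insert a U))
    obtain ⟨T, hT, hTcard, γ, hγ⟩ := hN α S' hcard.ge c
    have haT : a ∉ T := fun h => Finset.notMem_erase a S (hS' (hT h))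
    refine ⟨insert a T, Finset.insert_subset ha
      ((hT.trans hS').trans (Finset.erase_subset _ _)), by rw [Finset.card_insert_of_notMem haT,
      hTcard], Function.update γ a g, fun U hU hne hUcard => ?_⟩
    by_cases haU : a ∈ U
    · refine ⟨a, haU, ?_⟩
      have h1 := hg (U.erase a) ((Finset.subset_insert_iff.1 hU).trans hT)
        (by rw [Finset.card_erase_of_mem haU]; omega)
      rw [Finset.insert_erase haU, Finset.card_erase_of_mem haU] at h1
      rw [Function.update_self, h1]
    · obtain ⟨b, hb, hcb⟩ := hγ U ((Finset.subset_insert_iff_of_notMem haU).1 hU) hne hUcard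
      refine ⟨b, hb, ?_⟩
      rw [Function.update_of_ne (ne_of_mem_of_not_mem hb haU), hcb]

/-- Ramsey's theorem for colourings of all sets of at most `d` elements. -/
theorem Finset.exists_ramsey.{u, v} (K : Type v) [Finite K] (d m : ℕ) :
    ∃ N, ∀ (α : Type u) [DecidableEq α] (S : Finset α), N ≤ S.card →
      ∀ c : Finset α → K, ∃ T ⊆ S, T.card = m ∧
      ∃ g : ℕ → K, ∀ U ⊆ T, U.card ≤ d → c U = g U.card := by
  classical
  induction d generalizing m with
  | zero =>
    refine ⟨m, fun α _ S hS c => ?_⟩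
    obtain ⟨T, hT, hcard⟩ := Finset.exists_subset_card_eq hS
    refine ⟨T, hT, hcard, fun _ => c ∅, fun U _ hU => ?_⟩
    rw [Finset.card_eq_zero.1 (Nat.le_zero.1 hU)]
  | succ d ih =>
    have := Fintype.ofFinite K
    -- Pigeonhole over the possible palettes leaves m elements sharing one.
    obtain ⟨N, hN⟩ := Finset.exists_subset_color_eq_of_mem ih
      (Fintype.card (Fin (d + 1) → K) * m)
    refine ⟨N, fun α _ S hS c => ?_⟩
    have : Nonempty K := ⟨c ∅⟩
    obtain ⟨T, hT, hTcard, γ, hγ⟩ := hN α S hS c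
    obtain ⟨y, -, hy⟩ := Finset.exists_le_card_fiber_of_mul_le_card_of_maps_to (s := T)
      (t := Finset.univ) (f := fun a (i : Fin (d + 1)) => γ a i) (n := m)
      (fun _ _ => Finset.mem_univ _) Finset.univ_nonempty (by rw [hTcard, Finset.card_univ])
    obtain ⟨T', hT', hcard⟩ := Finset.exists_subset_card_eq hy
    refine ⟨T', (hT'.trans (Finset.filter_subset _ _)).trans hT, hcard,
      fun j => if h : 1 ≤ j ∧ j - 1 < d + 1 then y ⟨j - 1, h.2⟩ else c ∅, fun U hU hUd => ?_⟩
    rcases U.eq_empty_or_nonempty with rfl | hne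
    · simp
    · obtain ⟨a, ha, hca⟩ := hγ U (hU.trans (hT'.trans (Finset.filter_subset _ _))) hne hUd
      have hpos := hne.card_pos
      have hay := (Finset.mem_filter.1 (hT' (hU ha))).2
      have hcond : 1 ≤ U.card ∧ U.card - 1 < d + 1 := ⟨hpos, by omega⟩
      simp only [dif_pos hcond, hca, ← hay]

/-! ### Sensitivity and Simon's theorem. -/

namespace BoolFun

theorem flip_apply_self {n : ℕ} (x : Fin n → Bool) (t : Fin n) : flip x t t = !x t := by
  simp [flip]

theorem flip_apply_of_ne {n : ℕ} (x : Fin n → Bool) {t i : Fin n} (h : i ≠ t) :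
    flip x t i = x i := by
  simp [flip, h]

theorem flip_comm {n : ℕ} (x : Fin n → Bool) (s t : Fin n) :
    flip (flip x t) s = flip (flip x s) t := by
  by_cases h : s = t
  · rw [h]
  · funext i
    by_cases hs : i = s
    · subst hs; simp [flip, h]
    · by_cases ht : i = t
      · subst ht; simp [flip, hs]
      · simp [flip, hs, ht]

/-- A nonempty subset of the cube inducing a subgraph of minimum degree at least `m` has at least
`2 ^ m` elements. -/
theorem two_pow_le_card_of_le_degree {n : ℕ} (m : ℕ) (A : Finset (Fin n → Bool))
    (hne : A.Nonempty) (hdeg : ∀ x ∈ A, m ≤ (Finset.univ.filter fun j => flip x j ∈ A).card) :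
    2 ^ m ≤ A.card := by
  induction m generalizing A with
  | zero => simpa using hne.card_pos
  | succ m ih =>
    obtain ⟨x, hx⟩ := hne
    obtain ⟨i, hi⟩ := Finset.card_pos.1 (lt_of_lt_of_le (Nat.succ_pos m) (hdeg x hx))
    have hi := (Finset.mem_filter.1 hi).2
    -- An edge of A in direction i meets both halves, and within a half each vertex loses at most
    -- its neighbour in direction i.
    have hhalf : ∀ b, 2 ^ m ≤ (A.filter fun y => y i = b).card := by
      intro b
      refine ih _ ?_ fun y hy => ?_
      · by_cases hb : x i = b
        · exact ⟨x, Finset.mem_filter.2 ⟨hx, hb⟩⟩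
        · refine ⟨flip x i, Finset.mem_filter.2 ⟨hi, ?_⟩⟩
          rw [flip_apply_self]
          revert hb
          cases x i <;> cases b <;> simp
      · obtain ⟨hyA, hyb⟩ := Finset.mem_filter.1 hy
        have hsub : (Finset.univ.filter fun j => flip y j ∈ A).erase i ⊆
            Finset.univ.filter fun j => flip y j ∈ A.filter fun y => y i = b := by
          intro j hj
          obtain ⟨hji, hj⟩ := Finset.mem_erase.1 hj
          refine Finset.mem_filter.2 ⟨Finset.mem_univ _, Finset.mem_filter.2
            ⟨(Finset.mem_filter.1 hj).2, ?_⟩⟩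
          rw [flip_apply_of_ne _ (Ne.symm hji), hyb]
        have h1 := Finset.card_le_card hsub
        have h2 := Finset.pred_card_le_card_erase (s := Finset.univ.filter fun j => flip y j ∈ A)
          (a := i)
        have h3 := hdeg y hyA
        omega
    have hsplit := Finset.card_filter_add_card_filter_not (s := A) (fun y => y i = true)
    have h1 := hhalf true
    have h2 := hhalf false
    simp only [Bool.not_eq_true] at hsplit
    rw [pow_succ]
    omega

/-- The coordinates at which flipping a bit of `x` changes the value of `f`. -/
def sensitiveCoords {n : ℕ} (f : BoolFun n) (x : Fin n → Bool) : Finset (Fin n) :=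
  Finset.univ.filter fun t => f (flip x t) ≠ f x

theorem mem_sensitiveCoords {n : ℕ} {f : BoolFun n} {x : Fin n → Bool} {t : Fin n} :
    t ∈ f.sensitiveCoords x ↔ f (flip x t) ≠ f x := by
  simp [sensitiveCoords]

/-- Simon's theorem: a non-degenerate function of sensitivity at most `s` has at most `s 4^s`
variables. -/
theorem NonDegenerate.le_of_sensitivity_le {n : ℕ} {f : BoolFun n} (hf : f.NonDegenerate) {s : ℕ}
    (hs : ∀ x, (f.sensitiveCoords x).card ≤ s) : n ≤ s * 4 ^ s := by
  have hA : ∀ t, 2 ^ (n - 2 * s) ≤ (Finset.univ.filter fun x => t ∈ f.sensitiveCoords x).card := by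
    intro t
    refine two_pow_le_card_of_le_degree _ _ ?_ fun x hx => ?_
    · by_contra h
      refine hf ⟨t, fun x => ?_⟩
      by_contra hx
      exact h ⟨x, Finset.mem_filter.2 ⟨Finset.mem_univ _, mem_sensitiveCoords.2 (Ne.symm hx)⟩⟩
    · have hx := mem_sensitiveCoords.1 (Finset.mem_filter.1 hx).2
      -- If neither x nor `flip x t` is sensitive at j, flipping j preserves sensitivity at t.
      have hsub : (f.sensitiveCoords x ∪ f.sensitiveCoords (flip x t))ᶜ ⊆ Finset.univ.filter
          fun j => flip x j ∈ Finset.univ.filter fun x => t ∈ f.sensitiveCoords x := by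
        intro j hj
        simp only [Finset.mem_compl, Finset.mem_union, mem_sensitiveCoords, not_or,
          not_not] at hj
        simp only [Finset.mem_filter, Finset.mem_univ, true_and, mem_sensitiveCoords]
        rw [flip_comm, hj.2, hj.1]
        exact hx
      have h1 := Finset.card_le_card hsub
      have h2 := Finset.card_union_le (f.sensitiveCoords x) (f.sensitiveCoords (flip x t))
      rw [Finset.card_compl, Fintype.card_fin] at h1
      have := hs x
      have := hs (flip x t)
      omega
  -- Double count the pairs (x, t) with t sensitive at x.
  have hcount : n * 2 ^ (n - 2 * s) ≤ 2 ^ n * s := by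
    calc n * 2 ^ (n - 2 * s)
        = ∑ _t : Fin n, 2 ^ (n - 2 * s) := by simp
      _ ≤ ∑ t : Fin n, (Finset.univ.filter fun x => t ∈ f.sensitiveCoords x).card :=
          Finset.sum_le_sum fun t _ => hA t
      _ = ∑ x : Fin n → Bool, (f.sensitiveCoords x).card := by
          simp only [Finset.card_filter]
          rw [Finset.sum_comm]
          refine Finset.sum_congr rfl fun x _ => ?_
          rw [← Finset.card_filter, Finset.filter_univ_mem]
      _ ≤ ∑ _x : Fin n → Bool, s := Finset.sum_le_sum fun x _ => hs x
      _ = 2 ^ n * s := by simp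
  have hpow : 2 ^ n ≤ 2 ^ (n - 2 * s) * 4 ^ s := by
    rw [show (4 : ℕ) = 2 ^ 2 by norm_num, ← pow_mul, ← pow_add]
    exact Nat.pow_le_pow_right (by norm_num) (by omega)
  have hpos : 0 < 2 ^ (n - 2 * s) := by positivity
  refine Nat.le_of_mul_le_mul_right ?_ hpos
  calc n * 2 ^ (n - 2 * s) ≤ 2 ^ n * s := hcount
    _ ≤ 2 ^ (n - 2 * s) * 4 ^ s * s := Nat.mul_le_mul_right _ hpow
    _ = s * 4 ^ s * 2 ^ (n - 2 * s) := by ring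

end BoolFun

/-! ### Expansion around a point and the lower bound. -/

namespace BoolFun

theorem bit_pow (m : ℕ) (b : Bool) {e : ℕ} (he : e ≠ 0) : bit m b ^ e = bit m b := by
  cases b <;> simp [bit, he]

/-- The values of `f` on a cube centred at `x`, as sums of coefficients that vanish on sets of
more than `modDegree m f` elements. -/
theorem exists_coeff_of_modDegree_lt {n m D : ℕ} {f : BoolFun n} (hD : modDegree m f < D)
    (x : Fin n → Bool) : ∃ c : Finset (Fin n) → ZMod m, (∀ U, D ≤ U.card → c U = 0) ∧
      ∀ T : Finset (Fin n), bit m (f fun i => if i ∈ T then !x i else x i) =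
        ∑ U ∈ T.powerset, c U := by
  classical
  set P := poly m f with hP
  set a : Fin n → ZMod m := fun i => bit m (x i)
  set b : Fin n → ZMod m := fun i => bit m (!x i) - bit m (x i)
  -- Each bit is a i plus b i times the indicator of T; multiply out over s.
  have hterm : ∀ (s T : Finset (Fin n)), ∏ i ∈ s, bit m (if i ∈ T then !x i else x i) =
      ∑ U ∈ T.powerset, if U ⊆ s then (∏ i ∈ U, b i) * ∏ i ∈ s \ U, a i else 0 := by
    intro s T
    have h1 : ∀ i, bit m (if i ∈ T then !x i else x i) = (if i ∈ T then b i else 0) + a i := by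
      intro i
      split_ifs <;> simp [a, b]
    simp only [h1]
    rw [Finset.prod_add, ← Finset.sum_filter]
    have h2 : ∀ U ∈ s.powerset, (∏ i ∈ U, if i ∈ T then b i else 0) * ∏ i ∈ s \ U, a i =
        if U ⊆ T then (∏ i ∈ U, b i) * ∏ i ∈ s \ U, a i else 0 := by
      intro U _
      split_ifs with hU
      · congr 1
        exact Finset.prod_congr rfl fun i hi => if_pos (hU hi)
      · obtain ⟨i, hi, hiT⟩ := Finset.not_subset.1 hU
        rw [Finset.prod_eq_zero hi (if_neg hiT), zero_mul]
    rw [Finset.sum_congr rfl h2, ← Finset.sum_filter]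
    refine Finset.sum_congr ?_ fun _ _ => rfl
    ext U
    simp [and_comm]
  refine ⟨fun U => ∑ e ∈ P.support, P.coeff e *
    if U ⊆ e.support then (∏ i ∈ U, b i) * ∏ i ∈ e.support \ U, a i else 0, ?_, ?_⟩
  · intro U hU
    refine Finset.sum_eq_zero fun e he => ?_
    rw [if_neg, mul_zero]
    intro hUe
    have h1 : e.support.card ≤ e.sum fun _ k => k := by
      have := Finset.card_nsmul_le_sum e.support (fun i => e i) 1
        fun i hi => Nat.one_le_iff_ne_zero.2 (Finsupp.mem_support_iff.1 hi)
      simpa [Finsupp.sum] using this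
    have h2 := MvPolynomial.le_totalDegree he
    have h3 := Finset.card_le_card hUe
    have h4 : P.totalDegree < D := hD
    omega
  · intro T
    rw [← (isRepresentation_poly m f).2, MvPolynomial.eval_eq, Finset.sum_comm]
    refine Finset.sum_congr rfl fun e _ => ?_
    rw [← Finset.mul_sum, ← hterm]
    congr 1
    exact Finset.prod_congr rfl fun i hi => bit_pow m _ (Finsupp.mem_support_iff.1 hi)

end BoolFun

theorem fwdDiff_iter_sum_choose_mul {R : Type*} [Ring R] (D : ℕ) (g : ℕ → R) :
    (fwdDiff 1)^[D] (fun j : ℕ => ∑ i ∈ Finset.range D, (j.choose i : R) * g i) = 0 := by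
  have hsum : (fun j : ℕ => ∑ i ∈ Finset.range D, (j.choose i : R) * g i) =
      ∑ i ∈ Finset.range D, fun j : ℕ => (j.choose i : R) * g i := by
    funext j
    simp
  rw [hsum, fwdDiff_iter_finsetSum]
  refine Finset.sum_eq_zero fun i hi => ?_
  have hz : (fwdDiff 1)^[i + 1] (fun j : ℕ => (j.choose i : ℤ)) = 0 := by
    have h := fwdDiff_iter_choose 0 i
    simp only [add_zero, Nat.choose_zero_right, Nat.cast_one] at h
    rw [Function.iterate_succ_apply', h]
    exact fwdDiff_const 1 (1 : ℤ)
  have hz' := fwdDiff_iter_eq_zero_of_le hz (Nat.succ_le_of_lt (Finset.mem_range.1 hi))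
  funext y
  have h1 := congrFun hz' y
  rw [fwdDiff_iter_eq_sum_shift] at h1 ⊢
  have h2 := congrArg (fun z : ℤ => (z : R) * g i) h1
  simp only [Int.cast_sum, Finset.sum_mul, Pi.zero_apply, Int.cast_zero, zero_mul] at h2
  rw [Pi.zero_apply, ← h2]
  refine Finset.sum_congr rfl fun j _ => ?_
  simp [mul_assoc]

namespace BoolFun

theorem exists_forall_le_modDegree {p k : ℕ} (hp : p.Prime) (hk : 1 ≤ k) :
    ∃ N : ℕ, ∀ n : ℕ, N ≤ n → ∀ f : BoolFun n, f.NonDegenerate →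
      (p - 1) * k ≤ modDegree (p ^ k) f := by
  set D := (p - 1) * k with hD
  have hDpos : 1 ≤ D := Nat.mul_pos (by have := hp.two_le; omega) hk
  set M := p ^ (k + D) with hM
  have hMpos : 0 < M := pow_pos hp.pos _
  have : NeZero (p ^ k) := ⟨(pow_pos hp.pos k).ne'⟩
  have : Fact (1 < p ^ k) := ⟨Nat.one_lt_pow (by omega) hp.one_lt⟩
  obtain ⟨N, hN⟩ := Finset.exists_ramsey.{0, 0} (ZMod (p ^ k)) D M
  -- One more than Simon's bound for sensitivity N.
  refine ⟨N * 4 ^ N + 1, fun n hn f hf => ?_⟩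
  by_contra! hlt
  obtain ⟨x, hx⟩ : ∃ x, N < (f.sensitiveCoords x).card := by
    by_contra! hall
    have := hf.le_of_sensitivity_le hall
    omega
  obtain ⟨c, hc0, hc⟩ := exists_coeff_of_modDegree_lt hlt x
  obtain ⟨T, hTS, hTcard, g, hg⟩ := hN (Fin n) (f.sensitiveCoords x) hx.le c
  set h : ℕ → ZMod (p ^ k) := fun j => ∑ i ∈ Finset.range D, (j.choose i : ZMod (p ^ k)) * g i
    with hh
  have hval : ∀ U ⊆ T, bit (p ^ k) (f fun i => if i ∈ U then !x i else x i) = h U.card := by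
    intro U hU
    have h1 : ∀ V ∈ U.powerset, c V = if V.card < D then g V.card else 0 := by
      intro V hV
      split_ifs with hVD
      · exact hg V ((Finset.mem_powerset.1 hV).trans hU) hVD.le
      · exact hc0 V (not_lt.1 hVD)
    rw [hc, Finset.sum_congr rfl h1,
      Finset.sum_powerset_apply_card (fun i => if i < D then g i else 0)]
    simp only [hh, nsmul_eq_mul, mul_ite, mul_zero]
    rw [← Finset.sum_filter]
    refine Finset.sum_subset (fun i hi => ?_) fun i hi hi' => ?_
    · simp only [Finset.mem_filter] at hi
      exact Finset.mem_range.2 hi.2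
    · have : U.card < i := by
        simp only [Finset.mem_filter, Finset.mem_range] at hi hi'
        omega
      rw [Nat.choose_eq_zero_of_lt this, Nat.cast_zero, zero_mul]
  have hdiff : (fwdDiff 1)^[D] h = 0 := fwdDiff_iter_sum_choose_mul D g
  refine fwdDiff_iter_ne_zero_of_zero_one hp hk (h := h) (fun j => ?_) ?_ hdiff
  -- Sizes of subsets of T reach every residue modulo the period M, so h takes only values of f.
  · have hper := periodic_of_fwdDiff_iter_eq_zero hp k hdiff
    rw [← hper.map_mod_nat j]
    obtain ⟨U, hU, hUcard⟩ := Finset.exists_subset_card_eq (s := T) (n := j % M)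
      (by rw [hTcard]; exact (Nat.mod_lt j hMpos).le)
    rw [← hM, ← hUcard, ← hval U hU]
    cases f fun i => if i ∈ U then !x i else x i <;> simp [bit]
  · obtain ⟨t, ht⟩ := Finset.card_pos.1 (by omega : 0 < T.card)
    have h0 := hval ∅ (Finset.empty_subset T)
    have h1 := hval {t} (Finset.singleton_subset_iff.2 ht)
    rw [Finset.card_empty] at h0
    rw [Finset.card_singleton] at h1
    have hflip : (fun i => if i ∈ ({t} : Finset (Fin n)) then !x i else x i) = flip x t := by
      funext i
      by_cases hi : i = t
      · subst hi; simp [flip]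
      · simp [flip, hi]
    rw [hflip] at h1
    rw [← h0, ← h1]
    have hs := mem_sensitiveCoords.1 (hTS ht)
    simp only [Finset.notMem_empty, if_false]
    revert hs
    cases f x <;> cases f (flip x t) <;> simp [bit]

/-! ### The extremal function. -/

/-- The function testing whether the number of ones is divisible by `p`. -/
def dvdWeight (p n : ℕ) : BoolFun n :=
  fun x => decide (p ∣ (Finset.univ.filter fun i => x i = true).card)

theorem nonDegenerate_dvdWeight {p : ℕ} (hp : p.Prime) (n : ℕ) :
    (dvdWeight p n).NonDegenerate := by
  rintro ⟨t, ht⟩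
  have h := ht fun _ => false
  have hflip : (Finset.univ.filter fun i => flip (fun _ => false) t i = true) = {t} := by
    ext i
    by_cases hi : i = t
    · subst hi; simp [flip]
    · simp [flip, hi]
  simp [dvdWeight, hflip, hp.one_lt.ne'] at h

theorem modDegree_dvdWeight_le {p k : ℕ} (hp : p.Prime) (hk : 1 ≤ k) (n : ℕ) :
    modDegree (p ^ k) (dvdWeight p n) ≤ (p - 1) * k := by
  classical
  have : Fact (1 < p ^ k) := ⟨Nat.one_lt_pow (by omega) hp.one_lt⟩
  set D := (p - 1) * k with hD
  set g : ℕ → ℤ := fun j => if p ∣ j then 1 else 0 with hg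
  have hper : g.Periodic p := fun j => by simp [hg]
  set c : ℕ → ZMod (p ^ k) := fun i => (((fwdDiff 1)^[i] g 0 : ℤ) : ZMod (p ^ k)) with hc
  have hc0 : ∀ i, D < i → c i = 0 := fun i hi => by
    rw [hc, ZMod.intCast_zmod_eq_zero_iff_dvd]
    exact_mod_cast hper.dvd_fwdDiff_iter hp k hi 0
  -- Newton's expansion of g at 0, cut off at D: C(w, i) is the i-th elementary symmetric polynomial
  -- at a 0-1 point of weight w.
  set P : MvPolynomial (Fin n) (ZMod (p ^ k)) :=
    ∑ U ∈ Finset.univ.filter (fun U : Finset (Fin n) => U.card ≤ D),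
      MvPolynomial.C (c U.card) * ∏ i ∈ U, MvPolynomial.X i with hP
  have hrep : IsRepresentation (p ^ k) (dvdWeight p n) P := by
    constructor
    · intro i
      refine (MvPolynomial.degreeOf_sum_le i _ _).trans (Finset.sup_le fun U _ => ?_)
      refine (MvPolynomial.degreeOf_C_mul_le _ _ _).trans ?_
      refine (MvPolynomial.degreeOf_prod_le i _ _).trans ?_
      simp only [MvPolynomial.degreeOf_X]
      rw [Finset.sum_ite_eq]
      split_ifs <;> simp
    · intro x
      set S := Finset.univ.filter fun i => x i = true with hS
      have hprod : ∀ U : Finset (Fin n), ∏ i ∈ U, bit (p ^ k) (x i) = if U ⊆ S then 1 else 0 := by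
        intro U
        split_ifs with hU
        · refine Finset.prod_eq_one fun i hi => ?_
          rw [(Finset.mem_filter.1 (hU hi)).2]
          rfl
        · obtain ⟨i, hi, hiS⟩ := Finset.not_subset.1 hU
          refine Finset.prod_eq_zero hi ?_
          have : x i = false := by simpa [hS] using hiS
          rw [this]
          rfl
      have hgS : ((g S.card : ℤ) : ZMod (p ^ k)) = bit (p ^ k) (dvdWeight p n x) := by
        simp only [hg, dvdWeight, bit, ← hS, decide_eq_true_eq]
        split_ifs <;> simp
      have hshift := shift_eq_sum_fwdDiff_iter 1 g S.card 0
      rw [zero_add, smul_eq_mul, mul_one] at hshift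
      rw [← hgS, hshift]
      simp only [hP, map_sum, map_mul, map_prod, MvPolynomial.eval_C, MvPolynomial.eval_X, hprod,
        mul_ite, mul_one, mul_zero]
      push_cast
      rw [← Finset.sum_filter, Finset.filter_filter]
      have hpow := Finset.sum_powerset_apply_card c (x := S)
      simp only [nsmul_eq_mul] at hpow ⊢
      simp only [Int.cast_mul, Int.cast_natCast]
      rw [← hpow]
      refine Finset.sum_subset (fun U hU => ?_) fun U hU hU' => ?_
      · simp only [Finset.mem_filter] at hU
        exact Finset.mem_powerset.2 hU.2.2
      · refine hc0 _ ?_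
        simp only [Finset.mem_filter, Finset.mem_univ, true_and, Finset.mem_powerset] at hU hU'
        by_contra hle
        exact hU' ⟨not_lt.1 hle, hU⟩
  rw [modDegree, ← (isRepresentation_iff _ _ P).1 hrep]
  refine MvPolynomial.totalDegree_finsetSum_le fun U hU => ?_
  refine (MvPolynomial.totalDegree_mul _ _).trans ?_
  rw [MvPolynomial.totalDegree_C, zero_add]
  refine (MvPolynomial.totalDegree_finsetProd _ _).trans ?_
  simpa using hU

end BoolFun

theorem theorem2 (p k : ℕ) (hp : p.Prime) (hk : 1 ≤ k) :
    (∃ N : ℕ, ∀ n : ℕ, N ≤ n → ∀ f : BoolFun n, f.NonDegenerate →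
      (p - 1) * k ≤ BoolFun.modDegree (p ^ k) f) ∧
    (∃ N : ℕ, ∀ n : ℕ, N ≤ n → ∃ f : BoolFun n, f.NonDegenerate ∧
      BoolFun.modDegree (p ^ k) f = (p - 1) * k) := by
  obtain ⟨N, hN⟩ := BoolFun.exists_forall_le_modDegree hp hk
  refine ⟨⟨N, hN⟩, N, fun n hn => ⟨BoolFun.dvdWeight p n, BoolFun.nonDegenerate_dvdWeight hp n, ?_⟩⟩
  exact le_antisymm (BoolFun.modDegree_dvdWeight_le hp hk n)
    (hN n hn _ (BoolFun.nonDegenerate_dvdWeight hp n))
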